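/- Let $c>0$. For $m\ge 0$ let $(c)_m=c(c+1)\cdots(c+m-1)$, with $(c)_0=1$. Let $\mu$ and $\nu$ be probability measures on $\mathbb R$. If $\int_{\mathbb R}\log(1+|u|)\,d\mu(u)<\infty$ and, for every $z\in\mathbb C\setminus\mathbb R$, $$\int_{\mathbb R}\frac{1}{(z-t)^c}\,d\nu(t)=\exp\Big(-c\int_{\mathbb R}\log(z-u)\,d\mu(u)\Big),$$ where $\log$ and the power are the principal branches, then $\nu$ is called the Markov–Krein transform of $\mu$ with parameter $c$, written $\nu=\mathcal M_c(\mu)$. Two real sequences $(h_n)_{n\ge0}$ and $(p_n)_{n\ge0}$ are said to satisfy the moment relation (with parameter $c$) if $$h_0=1,\qquad (c)_n\,h_n=c\sum_{i=0}^{n-1}\frac{(n-1)!}{i!}\,(c)_i\,h_i\,p_{n-i}\quad(n=1,2,\dots).\tag{$*$}$$ **Theorem.** (1) Let $\mu$ be a probability measure on $\mathbb R$ all of whose moments $p_n=\int u^n\,d\mu(u)$, $n\ge0$, are finite. Then there is exactly one probability measure $\nu$ with $\nu=\mathcal M_c(\mu)$; there is exactly one sequence $(h_n)_{n\ge0}$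 satisfying $(*)$; and all moments of $\nu=\mathcal M_c(\mu)$ are finite, with $\int t^n\,d\nu(t)=h_n$ for all $n\ge0$. (2) Let $\mu$ and $\nu$ be probability measures on $\mathbb R$ that are determined by their moments (all moments are finite, and no other probability measure has the same moments), with moments $p_n=\int u^n\,d\mu(u)$ and $h_n=\int t^n\,d\nu(t)$. Then $(*)$ holds if and only if $\nu=\mathcal M_c(\mu)$. -/

import Mathlib

open MeasureTheory

/-- All moments of `μ` are finite: every monomial is `μ`-integrable. -/
def HasFiniteMoments (μ : Measure ℝ) : Prop :=
  ∀ n : ℕ, Integrable (fun u : ℝ => u ^ n) μ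

/-- The `n`-th moment of a measure on the real line. -/
noncomputable def momentSeq (μ : Measure ℝ) (n : ℕ) : ℝ :=
  ∫ u, u ^ n ∂μ

/-- `ν` is the Markov--Krein transform of `μ` with parameter `c`: both are probability measures,
`log (1 + |u|)` is `μ`-integrable, and the Markov--Krein relation holds off the real axis.
`Complex.log` and the complex power are the principal branches. -/
structure IsMarkovKreinTransform (c : ℝ) (μ ν : Measure ℝ) : Prop where
  isProbabilityMeasure_source : IsProbabilityMeasure μ
  isProbabilityMeasure_target : IsProbabilityMeasure ν
  integrable_log : Integrable (fun u : ℝ => Real.log (1 + |u|)) μ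
  relation : ∀ z : ℂ, z.im ≠ 0 →
    ∫ t : ℝ, 1 / (z - (t : ℂ)) ^ (c : ℂ) ∂ν
      = Complex.exp (-(c : ℂ) * ∫ u : ℝ, Complex.log (z - (u : ℂ)) ∂μ)

/-- The Pochhammer symbol `(c)_n = c (c + 1) ⋯ (c + n - 1)`, with `(c)_0 = 1`. -/
noncomputable def pochhammerSymbol (c : ℝ) (n : ℕ) : ℝ :=
  ∏ i ∈ Finset.range n, (c + (i : ℝ))

/-- The recursive moment relation with parameter `c` between the sequences `h` and `p`. -/
def MomentRelation (c : ℝ) (h p : ℕ → ℝ) : Prop :=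
  h 0 = 1 ∧ ∀ n : ℕ, 1 ≤ n →
    pochhammerSymbol c n * h n
      = c * ∑ i ∈ Finset.range n,
          ((Nat.factorial (n - 1) : ℝ) / (Nat.factorial i : ℝ))
            * pochhammerSymbol c i * h i * p (n - i)

/-- The probability measure `μ` is determined by its moments: they are all finite, and `μ` is the
only probability measure that has these moments. -/
structure IsDeterminedByMoments (μ : Measure ℝ) : Prop where
  isProbabilityMeasure : IsProbabilityMeasure μ
  hasFiniteMoments : HasFiniteMoments μ
  eq_of_moments_eq : ∀ ρ : Measure ℝ, IsProbabilityMeasure ρ → HasFiniteMoments ρ →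
    (∀ n : ℕ, momentSeq ρ n = momentSeq μ n) → ρ = μ

/-! The transform is realised as a stationary law. Let `V` have density `c v^(c-1)` on `(0, 1]`, let
`X` have law `μ` and `T` law `ν`, all independent. The claim is that `ν = M_c(μ)` as soon as `(1 -
V) X + V T` again has law `ν`. Write `F(z) = ∫ (z - t)^(-c) dν` and `L(z) = ∫ log (z - u) dμ`.
Averaging a power over the segment from `z - X` to `z - T` gives `∫ (z - t)^(-c-1) dν = L'(z) F(z)`
(`integral_cpow_sub_one_of_stationary`). Hence `F' = -c L' F`, so `F exp(c L)` is constant on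
vertical rays of the upper half-plane, and its limit at `i∞` is `1`. A stationary law is obtained by
iterating the affine map from `δ₀`: characteristic functions converge geometrically, and convexity
carries the moment bounds of `μ` to the limit (`exists_stickBreakingLaw_eq_self`). Taking `n`-th
moments in the stationarity equation yields `(*)` (`momentRelation_of_stationary`). Uniqueness of
`ν` comes from writing `F` on `Im z = 1` as a Fourier integral of the characteristic function
(`Measure.eq_of_integral_cpow_eq`). Part (2) follows, since `(*)` determines `h` recursively from
`p`. -/

open Filter

/-! ### The Beta(c, 1) law and its mixed moments -/

/-- The law of `U ^ (1 / c)` for `U` uniform on `(0, 1]`, that is, the Beta law with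
parameters `(c, 1)`. -/
noncomputable def betaOneMeasure (c : ℝ) : Measure ℝ :=
  (volume.restrict (Set.Ioc (0 : ℝ) 1)).map (fun u : ℝ => u ^ c⁻¹)

theorem isProbabilityMeasure_betaOneMeasure (c : ℝ) :
    IsProbabilityMeasure (betaOneMeasure c) := by
  have : IsProbabilityMeasure (volume.restrict (Set.Ioc (0 : ℝ) 1)) := ⟨by simp⟩
  exact Measure.isProbabilityMeasure_map (by fun_prop)

theorem ae_mem_Icc_betaOneMeasure {c : ℝ} (hc : 0 < c) :
    ∀ᵐ v ∂betaOneMeasure c, v ∈ Set.Icc (0 : ℝ) 1 := by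
  refine (ae_map_iff (p := (· ∈ Set.Icc (0 : ℝ) 1)) (by fun_prop) measurableSet_Icc).2 ?_
  filter_upwards [ae_restrict_mem measurableSet_Ioc] with u hu
  exact ⟨by have := hu.1; positivity, Real.rpow_le_one hu.1.le hu.2 (by positivity)⟩

theorem integral_betaOneMeasure {E : Type*} [NormedAddCommGroup E] [NormedSpace ℝ E]
    (c : ℝ) {f : ℝ → E} (hf : StronglyMeasurable f) :
    ∫ v, f v ∂betaOneMeasure c = ∫ u in (0 : ℝ)..1, f (u ^ c⁻¹) := by
  rw [betaOneMeasure, integral_map (by fun_prop) hf.aestronglyMeasurable,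
    intervalIntegral.integral_of_le zero_le_one]

theorem integrable_one_sub_pow_mul_pow_betaOneMeasure {c : ℝ} (hc : 0 < c) (k m : ℕ) :
    Integrable (fun v : ℝ => (1 - v) ^ k * v ^ m) (betaOneMeasure c) := by
  have := isProbabilityMeasure_betaOneMeasure c
  refine Integrable.of_bound (C := 1) (by fun_prop) ?_
  filter_upwards [ae_mem_Icc_betaOneMeasure hc] with v hv
  have h1 : 0 ≤ 1 - v := sub_nonneg.2 hv.2
  have h2 := hv.1
  rw [Real.norm_of_nonneg (by positivity)]
  exact mul_le_one₀ (pow_le_one₀ h1 (by linarith)) (by positivity) (pow_le_one₀ h2 hv.2)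

theorem pochhammerSymbol_succ (c : ℝ) (n : ℕ) :
    pochhammerSymbol c (n + 1) = pochhammerSymbol c n * (c + n) :=
  Finset.prod_range_succ _ _

theorem pochhammerSymbol_pos {c : ℝ} (hc : 0 < c) (n : ℕ) : 0 < pochhammerSymbol c n :=
  Finset.prod_pos fun _ _ => by positivity

theorem integral_one_sub_pow_mul_pow_betaOneMeasure {c : ℝ} (hc : 0 < c) (k m : ℕ) :
    ∫ v, (1 - v) ^ k * v ^ m ∂betaOneMeasure c
      = c * k.factorial * pochhammerSymbol c m / pochhammerSymbol c (m + k + 1) := by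
  induction k generalizing m with
  | zero =>
    have h : ∀ u ∈ Set.uIcc (0 : ℝ) 1, (u ^ c⁻¹) ^ m = u ^ (c⁻¹ * m) := fun u hu => by
      rw [Set.uIcc_of_le zero_le_one] at hu
      rw [Real.rpow_mul hu.1, Real.rpow_natCast]
    have hp := pochhammerSymbol_pos hc m
    have hcm : 0 < c + m := by positivity
    simp only [pow_zero, one_mul]
    rw [integral_betaOneMeasure c (by fun_prop), intervalIntegral.integral_congr h,
      integral_rpow (Or.inl (by have : 0 ≤ c⁻¹ * m := by positivity
                                linarith))]
    rw [add_zero, pochhammerSymbol_succ, Real.one_rpow, Real.zero_rpow (by positivity)]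
    simp only [Nat.factorial_zero, Nat.cast_one]
    field_simp
    ring
  | succ k ih =>
    -- Splitting off one factor `1 - v` lowers `k` at the cost of raising `m`, hence the induction
    -- with `m` general.
    have h : ∀ v : ℝ, (1 - v) ^ (k + 1) * v ^ m
        = (1 - v) ^ k * v ^ m - (1 - v) ^ k * v ^ (m + 1) := fun v => by ring
    simp_rw [h]
    rw [integral_sub (integrable_one_sub_pow_mul_pow_betaOneMeasure hc _ _)
      (integrable_one_sub_pow_mul_pow_betaOneMeasure hc _ _), ih, ih]
    have hp := pochhammerSymbol_pos hc m
    have hp1 := pochhammerSymbol_pos hc (m + k + 1)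
    have hcm : 0 < c + (m + k + 1 : ℕ) := by positivity
    rw [show m + 1 + k + 1 = m + k + 1 + 1 by ring, show m + (k + 1) + 1 = m + k + 1 + 1 by ring,
      pochhammerSymbol_succ c (m + k + 1), pochhammerSymbol_succ c m, Nat.factorial_succ]
    push_cast at hcm ⊢
    field_simp
    ring

/-! ### Stationarity implies the Markov–Krein relation -/

theorem HasDerivAt.cpow_const_real {f : ℝ → ℂ} {f' : ℂ} {x : ℝ} (hf : HasDerivAt f f' x) (a : ℂ)
    (hx : f x ∈ Complex.slitPlane) :
    HasDerivAt (fun y => f y ^ a) (a * f x ^ (a - 1) * f') x := by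
  have h := ((hasDerivAt_id (f x)).cpow_const (c := a) hx).comp x hf
  simpa [Function.comp_def] using h

/-- With `v = u^(1/c)` and `D(u) = (1 - v) w₁ + v w₂`, the integrand times `w₁` has the explicit
antiderivative `u D(u)^(-c)`, because `c u D'(u) = v (w₂ - w₁) = D(u) - w₁`. The segment stays in
the upper half-plane, away from the branch cut. -/
theorem integral_segment_cpow_betaOneMeasure {c : ℝ} (hc : 0 < c) {w₁ w₂ : ℂ}
    (h₁ : 0 < w₁.im) (h₂ : 0 < w₂.im) :
    ∫ v : ℝ, ((1 - v) * w₁ + v * w₂ : ℂ) ^ (-(c : ℂ) - 1) ∂betaOneMeasure c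
      = w₁⁻¹ * w₂ ^ (-(c : ℂ)) := by
  have him : ∀ u ∈ Set.Icc (0 : ℝ) 1,
      0 < ((1 - (u ^ c⁻¹ : ℝ)) * w₁ + (u ^ c⁻¹ : ℝ) * w₂ : ℂ).im := by
    intro u hu
    have h0 : 0 ≤ u ^ c⁻¹ := by have := hu.1; positivity
    have h1 : u ^ c⁻¹ ≤ 1 := Real.rpow_le_one hu.1 hu.2 (by positivity)
    have : ((1 - (u ^ c⁻¹ : ℝ)) * w₁ + (u ^ c⁻¹ : ℝ) * w₂ : ℂ).im
        = (1 - u ^ c⁻¹) * w₁.im + u ^ c⁻¹ * w₂.im := by simp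
    rw [this]
    rcases h0.eq_or_lt with h | h
    · rw [← h]; simpa using h₁
    · have := mul_pos h h₂
      have := mul_nonneg (sub_nonneg.2 h1) h₁.le
      linarith
  have hslit : ∀ u ∈ Set.Icc (0 : ℝ) 1,
      ((1 - (u ^ c⁻¹ : ℝ)) * w₁ + (u ^ c⁻¹ : ℝ) * w₂ : ℂ) ∈ Complex.slitPlane :=
    fun u hu => Or.inr (him u hu).ne'
  have hcont : Continuous fun u : ℝ => u ^ c⁻¹ :=
    Real.continuous_rpow_const (by positivity)
  have hcontD : Continuous fun u : ℝ =>
      ((1 - (u ^ c⁻¹ : ℝ)) * w₁ + (u ^ c⁻¹ : ℝ) * w₂ : ℂ) := by fun_prop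
  have hcontP : ∀ a : ℂ, ContinuousOn (fun u : ℝ =>
      ((1 - (u ^ c⁻¹ : ℝ)) * w₁ + (u ^ c⁻¹ : ℝ) * w₂ : ℂ) ^ a) (Set.Icc 0 1) := fun a =>
    hcontD.continuousOn.cpow continuousOn_const hslit
  have hw₁ : w₁ ≠ 0 := by rintro rfl; simp at h₁
  rw [integral_betaOneMeasure c (by
    refine Measurable.stronglyMeasurable ?_
    fun_prop)]
  have key := intervalIntegral.integral_eq_sub_of_hasDerivAt_of_le (zero_le_one' ℝ)
    (f := fun u : ℝ => (u : ℂ) * ((1 - (u ^ c⁻¹ : ℝ)) * w₁ + (u ^ c⁻¹ : ℝ) * w₂ : ℂ) ^ (-(c : ℂ)))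
    (f' := fun u : ℝ => w₁ *
      ((1 - (u ^ c⁻¹ : ℝ)) * w₁ + (u ^ c⁻¹ : ℝ) * w₂ : ℂ) ^ (-(c : ℂ) - 1))
    (by
      exact Complex.continuous_ofReal.continuousOn.mul (hcontP _))
    (fun u hu => by
      have hu' : u ∈ Set.Icc (0 : ℝ) 1 := ⟨hu.1.le, hu.2.le⟩
      have hr : HasDerivAt (fun u : ℝ => ((u ^ c⁻¹ : ℝ) : ℂ))
          ((c⁻¹ * u ^ (c⁻¹ - 1) : ℝ) : ℂ) u :=
        (Real.hasDerivAt_rpow_const (Or.inl hu.1.ne')).ofReal_comp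
      have hD : HasDerivAt (fun u : ℝ => ((1 - (u ^ c⁻¹ : ℝ)) * w₁ + (u ^ c⁻¹ : ℝ) * w₂ : ℂ))
          (((c⁻¹ * u ^ (c⁻¹ - 1) : ℝ) : ℂ) * (w₂ - w₁)) u := by
        convert! ((hr.const_sub 1).mul_const w₁).add (hr.mul_const w₂) using 1
        ring
      have hP := (hasDerivAt_id u).ofReal_comp.mul
        (hD.cpow_const_real (-(c : ℂ)) (hslit u hu'))
      convert! hP using 1
      have hne := Complex.slitPlane_ne_zero (hslit u hu')
      have hr' : (u : ℂ) * ((c⁻¹ * u ^ (c⁻¹ - 1) : ℝ) : ℂ) = (c : ℂ)⁻¹ * (u ^ c⁻¹ : ℝ) := by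
        rw [Real.rpow_sub_one hu.1.ne', ← Complex.ofReal_mul, ← Complex.ofReal_inv,
          ← Complex.ofReal_mul, mul_left_comm, mul_div_cancel₀ _ hu.1.ne']
      have hc' : (c : ℂ) ≠ 0 := by exact_mod_cast hc.ne'
      rw [Complex.cpow_sub _ _ hne, Complex.cpow_one]
      generalize ((1 - (u ^ c⁻¹ : ℝ)) * w₁ + (u ^ c⁻¹ : ℝ) * w₂ : ℂ) ^ (-(c : ℂ)) = P at *
      simp only [id, Complex.ofReal_one, one_mul]
      have e : (u : ℂ) * (-(c : ℂ) * (P / ((1 - (u ^ c⁻¹ : ℝ)) * w₁ + (u ^ c⁻¹ : ℝ) * w₂)) *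
          (((c⁻¹ * u ^ (c⁻¹ - 1) : ℝ) : ℂ) * (w₂ - w₁)))
          = ((u : ℂ) * ((c⁻¹ * u ^ (c⁻¹ - 1) : ℝ) : ℂ)) * (-(c : ℂ) * (P / ((1 - (u ^ c⁻¹ : ℝ)) * w₁
            + (u ^ c⁻¹ : ℝ) * w₂)) * (w₂ - w₁)) := by ring
      rw [e, hr']
      clear hP e hr' hD hr
      generalize ((u ^ c⁻¹ : ℝ) : ℂ) = V at *
      have hPQ := (mul_div_cancel₀ P hne).symm
      generalize P / ((1 - V) * w₁ + V * w₂) = Q at *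
      linear_combination (inv_mul_cancel₀ hc') * V * Q * (w₂ - w₁) - hPQ)
    (ContinuousOn.intervalIntegrable (by
      rw [Set.uIcc_of_le zero_le_one]
      exact continuousOn_const.mul (hcontP _)))
  rw [intervalIntegral.integral_const_mul] at key
  rw [eq_inv_mul_iff_mul_eq₀ hw₁, key]
  simp

/-- The law of `(1 - V) X + V T` for independent `V`, `X`, `T` with laws
`betaOneMeasure c`, `μ` and `ν`. -/
noncomputable def stickBreakingLaw (c : ℝ) (μ ν : Measure ℝ) : Measure ℝ :=
  ((betaOneMeasure c).prod (μ.prod ν)).map (fun p => (1 - p.1) * p.2.1 + p.1 * p.2.2)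

theorem norm_sub_ofReal_cpow_neg_le {z : ℂ} (hz : 0 < z.im) (t : ℝ) {a : ℝ} (ha : 0 ≤ a) :
    ‖(z - t : ℂ) ^ (-(a : ℂ))‖ ≤ z.im ^ (-a) := by
  have h : z.im ≤ ‖(z - t : ℂ)‖ := by
    have := Complex.abs_im_le_norm (z - t : ℂ)
    simp only [Complex.sub_im, Complex.ofReal_im, sub_zero] at this
    exact (le_abs_self _).trans this
  rw [← Complex.ofReal_neg, Complex.norm_cpow_real]
  exact Real.rpow_le_rpow_of_nonpos hz h (neg_nonpos.2 ha)

theorem sub_ofReal_mem_slitPlane {z : ℂ} (hz : 0 < z.im) (t : ℝ) :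
    (z - t : ℂ) ∈ Complex.slitPlane :=
  Or.inr (by simpa using hz.ne')

theorem integrable_sub_ofReal_cpow_neg (ν : Measure ℝ) [IsFiniteMeasure ν] {z : ℂ}
    (hz : 0 < z.im) {a : ℝ} (ha : 0 ≤ a) :
    Integrable (fun t : ℝ => (z - t : ℂ) ^ (-(a : ℂ))) ν :=
  Integrable.of_bound (Measurable.aestronglyMeasurable (by fun_prop)) _
    (Filter.Eventually.of_forall fun t => norm_sub_ofReal_cpow_neg_le hz t ha)

/-- Since `z - ((1 - v) x + v t) = (1 - v)(z - x) + v (z - t)`, integrating over `v` before the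
other variables separates `x` from `t`, and independence turns the integral into a product. -/
theorem integral_cpow_sub_one_of_stationary {c : ℝ} (hc : 0 < c) {μ ν : Measure ℝ}
    [IsProbabilityMeasure μ] [IsProbabilityMeasure ν] (hν : stickBreakingLaw c μ ν = ν)
    {z : ℂ} (hz : 0 < z.im) :
    ∫ t : ℝ, (z - t : ℂ) ^ (-(c : ℂ) - 1) ∂ν
      = (∫ u : ℝ, (z - u : ℂ)⁻¹ ∂μ) * ∫ t : ℝ, (z - t : ℂ) ^ (-(c : ℂ)) ∂ν := by
  have := isProbabilityMeasure_betaOneMeasure c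
  have hexp : -(c : ℂ) - 1 = -((c + 1 : ℝ) : ℂ) := by push_cast; ring
  have hint : Integrable (fun p : ℝ × ℝ × ℝ =>
      ((1 - p.1) * (z - p.2.1) + p.1 * (z - p.2.2) : ℂ) ^ (-(c : ℂ) - 1))
      ((betaOneMeasure c).prod (μ.prod ν)) := by
    refine Integrable.of_bound (C := z.im ^ (-(c + 1)))
      (Measurable.aestronglyMeasurable (by fun_prop))
      (Filter.Eventually.of_forall fun p => ?_)
    have e : ((1 - p.1) * (z - p.2.1) + p.1 * (z - p.2.2) : ℂ)
        = z - (((1 - p.1) * p.2.1 + p.1 * p.2.2 : ℝ) : ℂ) := by push_cast; ring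
    rw [e, hexp]
    exact norm_sub_ofReal_cpow_neg_le hz _ (by linarith)
  calc ∫ t : ℝ, (z - t : ℂ) ^ (-(c : ℂ) - 1) ∂ν
      = ∫ t : ℝ, (z - t : ℂ) ^ (-(c : ℂ) - 1) ∂(stickBreakingLaw c μ ν) := by rw [hν]
    _ = ∫ p : ℝ × ℝ × ℝ, ((1 - p.1) * (z - p.2.1) + p.1 * (z - p.2.2) : ℂ) ^ (-(c : ℂ) - 1)
          ∂((betaOneMeasure c).prod (μ.prod ν)) := by
        rw [stickBreakingLaw, integral_map (by fun_prop)
          (Measurable.aestronglyMeasurable (by fun_prop))]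
        congr 1 with p
        congr 1
        push_cast
        ring
    _ = ∫ q : ℝ × ℝ, (z - q.1 : ℂ)⁻¹ * (z - q.2 : ℂ) ^ (-(c : ℂ)) ∂(μ.prod ν) := by
        rw [integral_prod_symm _ hint]
        congr 1 with q
        exact integral_segment_cpow_betaOneMeasure hc (w₁ := z - q.1) (w₂ := z - q.2)
          (by simpa using hz) (by simpa using hz)
    _ = _ := integral_prod_mul (fun u : ℝ => (z - u : ℂ)⁻¹)
        (fun t : ℝ => (z - t : ℂ) ^ (-(c : ℂ)))

theorem hasDerivAt_integral_sub_ofReal_cpow {c : ℝ} (hc : 0 < c) (ν : Measure ℝ)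
    [IsFiniteMeasure ν] {z : ℂ} (hz : 0 < z.im) :
    HasDerivAt (fun z : ℂ => ∫ t : ℝ, (z - t : ℂ) ^ (-(c : ℂ)) ∂ν)
      (-(c : ℂ) * ∫ t : ℝ, (z - t : ℂ) ^ (-(c : ℂ) - 1) ∂ν) z := by
  have hexp : -(c : ℂ) - 1 = -((c + 1 : ℝ) : ℂ) := by push_cast; ring
  -- Keeping `w` above half the height of `z` bounds the derivative uniformly in `t`.
  have hopen : IsOpen {w : ℂ | z.im / 2 < w.im} := isOpen_lt continuous_const Complex.continuous_im
  rw [← integral_const_mul]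
  refine (hasDerivAt_integral_of_dominated_loc_of_deriv_le
    (F := fun (w : ℂ) (t : ℝ) => (w - t : ℂ) ^ (-(c : ℂ)))
    (F' := fun (w : ℂ) (t : ℝ) => -(c : ℂ) * (w - t : ℂ) ^ (-(c : ℂ) - 1))
    (bound := fun _ => c * (z.im / 2) ^ (-(c + 1)))
    (hopen.mem_nhds (show z.im / 2 < z.im by linarith))
    (Filter.Eventually.of_forall fun w => Measurable.aestronglyMeasurable (by fun_prop))
    (integrable_sub_ofReal_cpow_neg ν hz hc.le)
    (Measurable.aestronglyMeasurable (by fun_prop))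
    (Filter.Eventually.of_forall fun t w hw => ?_) (integrable_const _)
    (Filter.Eventually.of_forall fun t w hw => ?_)).2
  · have hw' : z.im / 2 < w.im := hw
    rw [norm_mul, hexp, norm_neg, Complex.norm_real, Real.norm_of_nonneg hc.le]
    gcongr
    refine (norm_sub_ofReal_cpow_neg_le (by linarith) t (by linarith)).trans ?_
    exact Real.rpow_le_rpow_of_nonpos (by linarith) hw'.le (by linarith)
  · have hw' : z.im / 2 < w.im := hw
    have := ((hasDerivAt_id w).sub_const (t : ℂ)).cpow_const (c := -(c : ℂ))
      (sub_ofReal_mem_slitPlane (show 0 < w.im by linarith) t)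
    simpa using this

theorem norm_clog_le (w : ℂ) : ‖Complex.log w‖ ≤ |Real.log ‖w‖| + Real.pi := by
  refine (Complex.norm_le_abs_re_add_abs_im _).trans ?_
  rw [Complex.log_re, Complex.log_im]
  gcongr
  exact Complex.abs_arg_le_pi w

theorem integrable_clog_sub_ofReal {μ : Measure ℝ} [IsFiniteMeasure μ]
    (hμ : Integrable (fun u : ℝ => Real.log (1 + |u|)) μ) {z : ℂ} (hz : 0 < z.im) :
    Integrable (fun u : ℝ => Complex.log (z - u)) μ := by
  refine (hμ.add (integrable_const (|Real.log z.im| + Real.log (1 + ‖z‖) + Real.pi))).mono'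
    (Measurable.aestronglyMeasurable (by fun_prop)) (Filter.Eventually.of_forall fun u => (norm_clog_le _).trans ?_)
  have h1 : z.im ≤ ‖(z - u : ℂ)‖ := by
    have := Complex.abs_im_le_norm (z - u : ℂ)
    simp only [Complex.sub_im, Complex.ofReal_im, sub_zero] at this
    exact (le_abs_self _).trans this
  have h2 : ‖(z - u : ℂ)‖ ≤ (1 + ‖z‖) * (1 + |u|) := by
    have := norm_sub_le z (u : ℂ)
    rw [Complex.norm_real, Real.norm_eq_abs] at this
    nlinarith [norm_nonneg z, abs_nonneg u, mul_nonneg (norm_nonneg z) (abs_nonneg u)]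
  have h3 := Real.log_le_log hz h1
  have h4 := Real.log_le_log (hz.trans_le h1) h2
  rw [Real.log_mul (by positivity) (by positivity)] at h4
  have h5 := neg_abs_le (Real.log z.im)
  have h6 : 0 ≤ Real.log (1 + ‖z‖) := Real.log_nonneg (by linarith [norm_nonneg z])
  have h7 : 0 ≤ Real.log (1 + |u|) := Real.log_nonneg (by linarith [abs_nonneg u])
  have h8 := abs_nonneg (Real.log z.im)
  have : |Real.log ‖(z - u : ℂ)‖| ≤ |Real.log z.im| + Real.log (1 + ‖z‖) + Real.log (1 + |u|) :=
    abs_le.2 ⟨by linarith, by linarith⟩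
  simp only [Pi.add_apply]
  linarith

theorem hasDerivAt_integral_clog_sub_ofReal {μ : Measure ℝ} [IsFiniteMeasure μ]
    (hμ : Integrable (fun u : ℝ => Real.log (1 + |u|)) μ) {z : ℂ} (hz : 0 < z.im) :
    HasDerivAt (fun z : ℂ => ∫ u : ℝ, Complex.log (z - u) ∂μ) (∫ u : ℝ, (z - u : ℂ)⁻¹ ∂μ) z := by
  have hopen : IsOpen {w : ℂ | z.im / 2 < w.im} := isOpen_lt continuous_const Complex.continuous_im
  refine (hasDerivAt_integral_of_dominated_loc_of_deriv_le
    (F := fun (w : ℂ) (t : ℝ) => Complex.log (w - t))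
    (F' := fun (w : ℂ) (t : ℝ) => (w - t : ℂ)⁻¹)
    (bound := fun _ => (z.im / 2)⁻¹)
    (hopen.mem_nhds (show z.im / 2 < z.im by linarith))
    (Filter.Eventually.of_forall fun w => Measurable.aestronglyMeasurable (by fun_prop))
    (integrable_clog_sub_ofReal hμ hz) (Measurable.aestronglyMeasurable (by fun_prop))
    (Filter.Eventually.of_forall fun t w hw => ?_) (integrable_const _)
    (Filter.Eventually.of_forall fun t w hw => ?_)).2
  · have hw' : z.im / 2 < w.im := hw
    rw [norm_inv]
    have := Complex.abs_im_le_norm (w - t : ℂ)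
    simp only [Complex.sub_im, Complex.ofReal_im, sub_zero] at this
    have := (le_abs_self _).trans this
    gcongr
    linarith
  · have hw' : z.im / 2 < w.im := hw
    have := ((hasDerivAt_id w).sub_const (t : ℂ)).clog
      (sub_ofReal_mem_slitPlane (show 0 < w.im by linarith) t)
    simpa using this

/-- The factor `i y` has argument `π/2` and the other factor lies in the right half-plane, so the
arguments add up without crossing the cut. -/
theorem clog_sub_ofReal_eq_add {x y : ℝ} (hy : 0 < y) (t : ℝ) :
    Complex.log (x + y * Complex.I - t)
      = Complex.log (y * Complex.I) + Complex.log (1 - ((x - t) / y : ℝ) * Complex.I) := by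
  have hy' : (y : ℂ) ≠ 0 := by exact_mod_cast hy.ne'
  have hre : 0 < (1 - (((x - t) / y : ℝ) : ℂ) * Complex.I).re := by simp
  have h0 : (1 - (((x - t) / y : ℝ) : ℂ) * Complex.I) ≠ 0 := fun h => by
    rw [h] at hre
    simp at hre
  have harg := Complex.abs_arg_lt_pi_div_two_iff.2 (Or.inl hre)
  rw [abs_lt] at harg
  rw [← Complex.log_mul (mul_ne_zero hy' Complex.I_ne_zero) h0]
  · congr 1
    push_cast
    field_simp
    linear_combination ((x : ℂ) - t) * Complex.I_mul_I
  · rw [Complex.arg_real_mul _ hy, Complex.arg_I]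
    constructor <;> linarith [Real.pi_pos]

theorem one_le_norm_one_sub_ofReal_mul_I (s : ℝ) : 1 ≤ ‖(1 - (s : ℂ) * Complex.I)‖ := by
  have := Complex.abs_re_le_norm (1 - (s : ℂ) * Complex.I)
  simpa using this

theorem tendsto_clog_one_sub_div_mul_I (s : ℝ) :
    Filter.Tendsto (fun y : ℝ => Complex.log (1 - ((s / y : ℝ) : ℂ) * Complex.I)) Filter.atTop
      (nhds 0) := by
  have h1 : Filter.Tendsto (fun y : ℝ => 1 - ((s / y : ℝ) : ℂ) * Complex.I) Filter.atTop
      (nhds (1 - ((0 : ℝ) : ℂ) * Complex.I)) :=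
    (((Complex.continuous_ofReal.tendsto _).comp
      (Filter.tendsto_id.const_div_atTop s)).mul_const _).const_sub 1
  have h2 := h1.clog (by simp)
  simpa using h2

/-- This fixes the constant of integration: the factors `(i y)^(-c)` and `(i y)^c` cancel, and what
remains tends to `1` by dominated convergence. -/
theorem tendsto_integral_cpow_mul_exp_integral_clog {c : ℝ} (hc : 0 < c) {μ ν : Measure ℝ}
    [IsProbabilityMeasure μ] [IsProbabilityMeasure ν]
    (hμ : Integrable (fun u : ℝ => Real.log (1 + |u|)) μ) (x : ℝ) :
    Filter.Tendsto (fun y : ℝ => (∫ t : ℝ, (x + y * Complex.I - t : ℂ) ^ (-(c : ℂ)) ∂ν)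
      * Complex.exp (c * ∫ u : ℝ, Complex.log (x + y * Complex.I - u) ∂μ)) Filter.atTop
      (nhds 1) := by
  have hA : Filter.Tendsto (fun y : ℝ => ∫ t : ℝ,
      Complex.exp (Complex.log (1 - ((x - t) / y : ℝ) * Complex.I) * -(c : ℂ)) ∂ν)
      Filter.atTop (nhds (∫ _ : ℝ, 1 ∂ν)) := by
    refine tendsto_integral_filter_of_dominated_convergence (fun _ => 1)
      (Filter.Eventually.of_forall fun y => Measurable.aestronglyMeasurable (by fun_prop))
      (Filter.Eventually.of_forall fun y => Filter.Eventually.of_forall fun t => ?_)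
      (integrable_const _) (Filter.Eventually.of_forall fun t => ?_)
    -- The base has modulus at least `1` and the exponent `-c` is negative, so the constant `1`
    -- dominates without any moment condition on `ν`.
    · have h1 := one_le_norm_one_sub_ofReal_mul_I ((x - t) / y)
      have h2 := Real.log_nonneg h1
      rw [Complex.norm_exp, Real.exp_le_one_iff, ← Complex.ofReal_neg, Complex.re_mul_ofReal,
        Complex.log_re]
      nlinarith
    · have := (Complex.continuous_exp.tendsto _).comp
        ((tendsto_clog_one_sub_div_mul_I (x - t)).mul_const (-(c : ℂ)))
      simpa [Function.comp_def] using this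
  have hbound : ∀ y : ℝ, 1 ≤ y → ∀ u : ℝ, ‖Complex.log (1 - ((x - u) / y : ℝ) * Complex.I)‖
      ≤ Real.log (1 + |u|) + (Real.log (1 + |x|) + Real.pi) := by
    intro y hy u
    refine (norm_clog_le _).trans ?_
    have h1 := one_le_norm_one_sub_ofReal_mul_I ((x - u) / y)
    have h2 : ‖(1 - ((x - u) / y : ℝ) * Complex.I)‖ ≤ (1 + |u|) * (1 + |x|) := by
      refine (norm_sub_le _ _).trans ?_
      rw [norm_mul, Complex.norm_I, Complex.norm_real, norm_one, mul_one, Real.norm_eq_abs, abs_div,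
        abs_of_pos (one_pos.trans_le hy)]
      have h3 := div_le_self (abs_nonneg (x - u)) hy
      have h4 := abs_sub x u
      nlinarith [mul_nonneg (abs_nonneg x) (abs_nonneg u)]
    have h3 := Real.log_le_log (one_pos.trans_le h1) h2
    rw [Real.log_mul (by positivity) (by positivity)] at h3
    rw [abs_of_nonneg (Real.log_nonneg h1)]
    linarith
  have hdom : Integrable
      (fun u : ℝ => Real.log (1 + |u|) + (Real.log (1 + |x|) + Real.pi)) μ :=
    hμ.add (integrable_const _)
  have hB : Filter.Tendsto (fun y : ℝ => ∫ u : ℝ,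
      Complex.log (1 - ((x - u) / y : ℝ) * Complex.I) ∂μ)
      Filter.atTop (nhds (∫ _ : ℝ, 0 ∂μ)) := by
    refine tendsto_integral_filter_of_dominated_convergence _
      (Filter.Eventually.of_forall fun y => Measurable.aestronglyMeasurable (by fun_prop))
      ?_ hdom (Filter.Eventually.of_forall fun u => tendsto_clog_one_sub_div_mul_I (x - u))
    filter_upwards [Filter.eventually_ge_atTop 1] with y hy
    exact Filter.Eventually.of_forall (hbound y hy)
  have hAB := hA.mul ((Complex.continuous_exp.tendsto _).comp (hB.const_mul (c : ℂ)))
  simp only [integral_const, probReal_univ, one_smul, mul_zero, Complex.exp_zero,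
    mul_one] at hAB
  refine hAB.congr' ?_
  filter_upwards [Filter.eventually_ge_atTop 1] with y hy
  have hy0 : 0 < y := one_pos.trans_le hy
  have hyI : (y : ℂ) * Complex.I ≠ 0 := mul_ne_zero (by exact_mod_cast hy0.ne') Complex.I_ne_zero
  have hF : ∫ t : ℝ, (x + y * Complex.I - t : ℂ) ^ (-(c : ℂ)) ∂ν
      = Complex.exp (Complex.log (y * Complex.I) * -(c : ℂ)) * ∫ t : ℝ,
        Complex.exp (Complex.log (1 - ((x - t) / y : ℝ) * Complex.I) * -(c : ℂ)) ∂ν := by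
    rw [← integral_const_mul]
    congr 1 with t
    have hne : (x + y * Complex.I - t : ℂ) ≠ 0 := fun h => by
      have := congrArg Complex.im h
      simp at this
      exact hy0.ne' this
    rw [Complex.cpow_def_of_ne_zero hne, clog_sub_ofReal_eq_add hy0, ← Complex.exp_add, add_mul]
  have hL : ∫ u : ℝ, Complex.log (x + y * Complex.I - u) ∂μ
      = Complex.log (y * Complex.I) + ∫ u : ℝ,
        Complex.log (1 - ((x - u) / y : ℝ) * Complex.I) ∂μ := by
    simp_rw [clog_sub_ofReal_eq_add hy0]
    rw [integral_add (integrable_const _)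
      (hdom.mono' (Measurable.aestronglyMeasurable (by fun_prop))
        (Filter.Eventually.of_forall (hbound y hy)))]
    simp
  rw [hF, hL, mul_add, Complex.exp_add, Function.comp_apply]
  have h1 : Complex.exp (Complex.log (y * Complex.I) * -(c : ℂ))
      * Complex.exp (c * Complex.log (y * Complex.I)) = 1 := by
    rw [← Complex.exp_add, ← Complex.exp_zero]
    congr 1
    ring
  linear_combination -((∫ t : ℝ,
        Complex.exp (Complex.log (1 - ((x - t) / y : ℝ) * Complex.I) * -(c : ℂ)) ∂ν)
      * Complex.exp (c * ∫ u : ℝ, Complex.log (1 - ((x - u) / y : ℝ) * Complex.I) ∂μ)) * h1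

theorem integral_cpow_eq_exp_of_stationary {c : ℝ} (hc : 0 < c) {μ ν : Measure ℝ}
    [IsProbabilityMeasure μ] [IsProbabilityMeasure ν]
    (hμ : Integrable (fun u : ℝ => Real.log (1 + |u|)) μ) (hν : stickBreakingLaw c μ ν = ν)
    {z : ℂ} (hz : 0 < z.im) :
    ∫ t : ℝ, (z - t : ℂ) ^ (-(c : ℂ)) ∂ν
      = Complex.exp (-(c : ℂ) * ∫ u : ℝ, Complex.log (z - u) ∂μ) := by
  set f : ℝ → ℂ := fun y => (∫ t : ℝ, (z.re + y * Complex.I - t : ℂ) ^ (-(c : ℂ)) ∂ν)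
      * Complex.exp (c * ∫ u : ℝ, Complex.log (z.re + y * Complex.I - u) ∂μ) with hf
  have hderiv : ∀ y ∈ Set.Ioi (0 : ℝ), HasDerivAt f 0 y := by
    intro y hy
    have him : 0 < (z.re + y * Complex.I : ℂ).im := by simpa using hy
    have hline : HasDerivAt (fun y : ℝ => (z.re + y * Complex.I : ℂ)) Complex.I y := by
      simpa using (((hasDerivAt_id y).ofReal_comp).mul_const Complex.I).const_add (z.re : ℂ)
    have h1 := (hasDerivAt_integral_sub_ofReal_cpow hc ν him).comp y hline
    have h2 := (((hasDerivAt_integral_clog_sub_ofReal hμ him).comp y hline).const_mul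
      (c : ℂ)).cexp
    rw [integral_cpow_sub_one_of_stationary hc hν him] at h1
    convert! h1.mul h2 using 1
    simp only [Function.comp_apply]
    ring
  have hconst : ∀ y ∈ Set.Ioi (0 : ℝ), f y = f z.im := fun y hy =>
    isOpen_Ioi.is_const_of_deriv_eq_zero (convex_Ioi (0 : ℝ)).isPreconnected
      (fun w hw => (hderiv w hw).differentiableAt.differentiableWithinAt)
      (fun w hw => (hderiv w hw).deriv) hy hz
  have hlim : Filter.Tendsto f Filter.atTop (nhds (f z.im)) :=
    tendsto_const_nhds.congr' (by
      filter_upwards [Filter.eventually_gt_atTop 0] with y hy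
      exact (hconst y hy).symm)
  have h1 := tendsto_nhds_unique hlim
    (tendsto_integral_cpow_mul_exp_integral_clog hc hμ z.re)
  simp only [hf, Complex.re_add_im] at h1
  rw [neg_mul, Complex.exp_neg]
  exact eq_inv_of_mul_eq_one_left h1

theorem isMarkovKreinTransform_of_stationary {c : ℝ} (hc : 0 < c) {μ ν : Measure ℝ}
    [IsProbabilityMeasure μ] [IsProbabilityMeasure ν]
    (hμ : Integrable (fun u : ℝ => Real.log (1 + |u|)) μ) (hν : stickBreakingLaw c μ ν = ν) :
    IsMarkovKreinTransform c μ ν := by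
  refine ⟨inferInstance, inferInstance, hμ, fun z hz => ?_⟩
  simp_rw [one_div, ← Complex.cpow_neg]
  rcases hz.lt_or_gt with hz | hz
  -- The lower half-plane follows by conjugation, which commutes with the principal branches off the
  -- real axis.
  · have h := congrArg (starRingEnd ℂ) (integral_cpow_eq_exp_of_stationary hc hμ hν
      (z := starRingEnd ℂ z) (by simpa using hz))
    rw [← integral_conj, ← Complex.exp_conj, map_mul, ← integral_conj] at h
    have harg : ∀ t : ℝ, (z - t : ℂ).arg ≠ Real.pi := fun t ht => by
      have := (Complex.arg_eq_pi_iff.1 ht).2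
      simp only [Complex.sub_im, Complex.ofReal_im, sub_zero] at this
      exact hz.ne this
    have e1 : ∀ t : ℝ, (starRingEnd ℂ) ((starRingEnd ℂ z - t) ^ (-(c : ℂ)))
        = (z - t : ℂ) ^ (-(c : ℂ)) := fun t => by
      have := Complex.cpow_conj (z - t : ℂ) (-(c : ℂ)) (harg t)
      simpa using this.symm
    have e2 : ∀ t : ℝ, (starRingEnd ℂ) (Complex.log (starRingEnd ℂ z - t))
        = Complex.log (z - t : ℂ) := fun t => by
      have := Complex.log_conj (z - t : ℂ) (harg t)
      rw [map_sub, Complex.conj_ofReal] at this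
      rw [this, Complex.conj_conj]
    simp_rw [e1, e2] at h
    simpa using h
  · exact integral_cpow_eq_exp_of_stationary hc hμ hν hz

/-! ### Existence of a stationary law with finite moments -/

theorem isProbabilityMeasure_stickBreakingLaw (c : ℝ) (μ ν : Measure ℝ)
    [IsProbabilityMeasure μ] [IsProbabilityMeasure ν] :
    IsProbabilityMeasure (stickBreakingLaw c μ ν) := by
  have := isProbabilityMeasure_betaOneMeasure c
  exact Measure.isProbabilityMeasure_map (by fun_prop)

theorem charFun_stickBreakingLaw (c : ℝ) (μ ν : Measure ℝ)
    [IsProbabilityMeasure μ] [IsProbabilityMeasure ν] (s : ℝ) :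
    charFun (stickBreakingLaw c μ ν) s
      = ∫ v : ℝ, charFun μ ((1 - v) * s) * charFun ν (v * s) ∂betaOneMeasure c := by
  have := isProbabilityMeasure_betaOneMeasure c
  rw [charFun_apply_real, stickBreakingLaw, integral_map (by fun_prop)
    (Measurable.aestronglyMeasurable (by fun_prop)), integral_prod]
  · congr 1 with v
    rw [charFun_apply_real, charFun_apply_real, ← integral_prod_mul]
    congr 1 with q
    rw [← Complex.exp_add]
    congr 1
    push_cast
    ring
  · refine Integrable.of_bound (C := 1) (Measurable.aestronglyMeasurable (by fun_prop))
      (Eventually.of_forall fun p => ?_)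
    rw [← Complex.ofReal_mul, Complex.norm_exp_ofReal_mul_I]

/-- Convexity of `x ↦ x^n` on `[0, ∞)`: a bound shared by `μ` and `ν` passes to the mixture with the
same constant, so it survives arbitrarily many iterations. -/
theorem lintegral_abs_pow_stickBreakingLaw_le {c : ℝ} (hc : 0 < c) {μ ν : Measure ℝ}
    [IsProbabilityMeasure μ] [IsProbabilityMeasure ν] {n : ℕ} {M : ENNReal}
    (hμ : ∫⁻ x, ENNReal.ofReal (|x| ^ n) ∂μ ≤ M) (hν : ∫⁻ t, ENNReal.ofReal (|t| ^ n) ∂ν ≤ M) :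
    ∫⁻ t, ENNReal.ofReal (|t| ^ n) ∂(stickBreakingLaw c μ ν) ≤ M := by
  have := isProbabilityMeasure_betaOneMeasure c
  rw [stickBreakingLaw, lintegral_map (by fun_prop) (by fun_prop), lintegral_prod _ (by fun_prop)]
  calc ∫⁻ v, ∫⁻ q : ℝ × ℝ, ENNReal.ofReal (|(1 - v) * q.1 + v * q.2| ^ n) ∂(μ.prod ν)
        ∂betaOneMeasure c
      ≤ ∫⁻ _, M ∂betaOneMeasure c := by
        refine lintegral_mono_ae ?_
        filter_upwards [ae_mem_Icc_betaOneMeasure hc] with v hv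
        have h1 : 0 ≤ 1 - v := sub_nonneg.2 hv.2
        have h2 := hv.1
        have hpt : ∀ x t : ℝ, ENNReal.ofReal (|(1 - v) * x + v * t| ^ n)
            ≤ ENNReal.ofReal (1 - v) * ENNReal.ofReal (|x| ^ n)
              + ENNReal.ofReal v * ENNReal.ofReal (|t| ^ n) := fun x t => by
          rw [← ENNReal.ofReal_mul h1, ← ENNReal.ofReal_mul h2,
            ← ENNReal.ofReal_add (by positivity) (by positivity)]
          refine ENNReal.ofReal_le_ofReal ?_
          have h3 : |(1 - v) * x + v * t| ≤ (1 - v) * |x| + v * |t| := by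
            refine (abs_add_le _ _).trans_eq ?_
            rw [abs_mul, abs_mul, abs_of_nonneg h1, abs_of_nonneg h2]
          refine (pow_le_pow_left₀ (abs_nonneg _) h3 n).trans ?_
          simpa using (convexOn_pow n).2 (abs_nonneg x) (abs_nonneg t) h1 h2 (by ring)
        calc ∫⁻ q : ℝ × ℝ, ENNReal.ofReal (|(1 - v) * q.1 + v * q.2| ^ n) ∂(μ.prod ν)
            ≤ ∫⁻ q : ℝ × ℝ, (ENNReal.ofReal (1 - v) * ENNReal.ofReal (|q.1| ^ n)
              + ENNReal.ofReal v * ENNReal.ofReal (|q.2| ^ n)) ∂(μ.prod ν) :=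
              lintegral_mono fun q => hpt q.1 q.2
          _ = ENNReal.ofReal (1 - v) * ∫⁻ x, ENNReal.ofReal (|x| ^ n) ∂μ
              + ENNReal.ofReal v * ∫⁻ t, ENNReal.ofReal (|t| ^ n) ∂ν := by
              rw [lintegral_add_left (by fun_prop), lintegral_const_mul _ (by fun_prop),
                lintegral_const_mul _ (by fun_prop), lintegral_prod _ (by fun_prop),
                lintegral_prod _ (by fun_prop)]
              simp
          _ ≤ ENNReal.ofReal (1 - v) * M + ENNReal.ofReal v * M := by gcongr
          _ = M := by
              rw [← add_mul, ← ENNReal.ofReal_add h1 h2]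
              simp
    _ = M := by simp

/-- The laws of the successive truncations of the stick-breaking series. -/
noncomputable def stickBreakingIterate (c : ℝ) (μ : Measure ℝ) : ℕ → Measure ℝ
  | 0 => Measure.dirac 0
  | k + 1 => stickBreakingLaw c μ (stickBreakingIterate c μ k)

theorem isProbabilityMeasure_stickBreakingIterate (c : ℝ) (μ : Measure ℝ)
    [IsProbabilityMeasure μ] (k : ℕ) : IsProbabilityMeasure (stickBreakingIterate c μ k) := by
  induction k with
  | zero => exact Measure.dirac.isProbabilityMeasure
  | succ k ih => exact isProbabilityMeasure_stickBreakingLaw c μ _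

theorem lintegral_abs_pow_stickBreakingIterate_le {c : ℝ} (hc : 0 < c) (μ : Measure ℝ)
    [IsProbabilityMeasure μ] (n k : ℕ) :
    ∫⁻ t, ENNReal.ofReal (|t| ^ n) ∂(stickBreakingIterate c μ k)
      ≤ ∫⁻ x, ENNReal.ofReal (|x| ^ n) ∂μ := by
  induction k with
  | zero =>
    rw [stickBreakingIterate, lintegral_dirac]
    rcases eq_or_ne n 0 with rfl | hn
    · simp
    · simp [hn]
  | succ k ih =>
    have := isProbabilityMeasure_stickBreakingIterate c μ k
    exact lintegral_abs_pow_stickBreakingLaw_le hc le_rfl ih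

theorem norm_charFun_sub_one_le {μ : Measure ℝ} [IsProbabilityMeasure μ]
    (hμ : Integrable (fun x : ℝ => x) μ) (s : ℝ) :
    ‖charFun μ s - 1‖ ≤ |s| * ∫ x, |x| ∂μ := by
  have h1 : charFun μ s - 1 = ∫ x : ℝ, (Complex.exp (Complex.I * ((s * x : ℝ) : ℂ)) - 1) ∂μ := by
    rw [integral_sub _ (integrable_const _)]
    · rw [charFun_apply_real]
      simp [mul_comm]
    · refine Integrable.of_bound (C := 1) (Measurable.aestronglyMeasurable (by fun_prop))
        (Eventually.of_forall fun x => ?_)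
      rw [mul_comm, Complex.norm_exp_ofReal_mul_I]
  rw [h1, ← integral_const_mul]
  refine norm_integral_le_of_norm_le (hμ.abs.const_mul _) (Eventually.of_forall fun x => ?_)
  refine (Real.norm_exp_I_mul_ofReal_sub_one_le).trans_eq ?_
  rw [Real.norm_eq_abs, abs_mul]

theorem integrable_charFun_mul_charFun_betaOneMeasure (c : ℝ) (μ ν : Measure ℝ)
    [IsProbabilityMeasure μ] [IsProbabilityMeasure ν] (s : ℝ) :
    Integrable (fun v : ℝ => charFun μ ((1 - v) * s) * charFun ν (v * s)) (betaOneMeasure c) := by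
  have := isProbabilityMeasure_betaOneMeasure c
  have h1 := (continuous_charFun (μ := μ)).measurable
  have h2 := (continuous_charFun (μ := ν)).measurable
  refine Integrable.of_bound (C := 1) (Measurable.aestronglyMeasurable (by fun_prop))
    (Eventually.of_forall fun v => ?_)
  rw [norm_mul]
  exact mul_le_one₀ (norm_charFun_le_one _) (norm_nonneg _) (norm_charFun_le_one _)

/-- The old characteristic function is evaluated at `v s`, so a bound linear in `|s|` gains a factor
`v`, and averaging gains `E[V]` at every step. The linear starting bound comes from the first moment
of `μ`. -/
theorem dist_charFun_stickBreakingIterate_le {c : ℝ} (hc : 0 < c) {μ : Measure ℝ}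
    [IsProbabilityMeasure μ] (hμ : Integrable (fun x : ℝ => x) μ) (k : ℕ) (s : ℝ) :
    dist (charFun (stickBreakingIterate c μ k) s) (charFun (stickBreakingIterate c μ (k + 1)) s)
      ≤ (|s| * ∫ x, |x| ∂μ) * (∫ v, v ∂betaOneMeasure c) ^ k := by
  have := isProbabilityMeasure_betaOneMeasure c
  have hprob := isProbabilityMeasure_stickBreakingIterate c μ
  have hM : 0 ≤ ∫ x, |x| ∂μ := integral_nonneg fun _ => abs_nonneg _
  have hv : Integrable (fun v : ℝ => v) (betaOneMeasure c) := by
    simpa using integrable_one_sub_pow_mul_pow_betaOneMeasure hc 0 1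
  rw [dist_comm, dist_eq_norm]
  induction k generalizing s with
  | zero =>
    rw [stickBreakingIterate, stickBreakingIterate, charFun_stickBreakingLaw]
    simp only [stickBreakingIterate, charFun_dirac, inner_zero_left, Complex.ofReal_zero, zero_mul, Complex.exp_zero,
      mul_one, pow_zero]
    have hi : Integrable (fun v : ℝ => charFun μ ((1 - v) * s)) (betaOneMeasure c) := by
      simpa using integrable_charFun_mul_charFun_betaOneMeasure c μ (Measure.dirac 0) s
    have h1 : (∫ v : ℝ, charFun μ ((1 - v) * s) ∂betaOneMeasure c) - 1
        = ∫ v : ℝ, (charFun μ ((1 - v) * s) - 1) ∂betaOneMeasure c := by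
      rw [integral_sub hi (integrable_const _)]
      simp
    rw [h1]
    refine (norm_integral_le_of_norm_le_const (C := |s| * ∫ x, |x| ∂μ) ?_).trans_eq (by simp)
    filter_upwards [ae_mem_Icc_betaOneMeasure hc] with v hv
    refine (norm_charFun_sub_one_le hμ _).trans ?_
    refine mul_le_mul_of_nonneg_right ?_ hM
    rw [abs_mul]
    refine mul_le_of_le_one_left (abs_nonneg _) (abs_le.2 ⟨?_, ?_⟩) <;> linarith [hv.1, hv.2]
  | succ k ih =>
    have hs : ∀ k, charFun (stickBreakingIterate c μ (k + 1)) s = ∫ v : ℝ, charFun μ ((1 - v) * s)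
        * charFun (stickBreakingIterate c μ k) (v * s) ∂betaOneMeasure c := fun k =>
      charFun_stickBreakingLaw c μ _ s
    rw [hs (k + 1), hs k, ← integral_sub (integrable_charFun_mul_charFun_betaOneMeasure _ _ _ _)
      (integrable_charFun_mul_charFun_betaOneMeasure _ _ _ _)]
    refine (norm_integral_le_of_norm_le (hv.const_mul
      ((|s| * ∫ x, |x| ∂μ) * (∫ v, v ∂betaOneMeasure c) ^ k)) ?_).trans_eq ?_
    · filter_upwards [ae_mem_Icc_betaOneMeasure hc] with v hv
      rw [← mul_sub, norm_mul]
      refine (mul_le_of_le_one_left (norm_nonneg _) (norm_charFun_le_one _)).trans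
        ((ih (v * s)).trans_eq ?_)
      rw [abs_mul, abs_of_nonneg hv.1]
      ring
    · rw [integral_const_mul, pow_succ]
      ring

theorem integral_id_betaOneMeasure_lt_one {c : ℝ} (hc : 0 < c) :
    ∫ v, v ∂betaOneMeasure c < 1 := by
  have h := integral_one_sub_pow_mul_pow_betaOneMeasure hc 0 1
  simp only [pow_zero, one_mul, pow_one] at h
  rw [h, div_lt_one (pochhammerSymbol_pos hc _)]
  simp only [pochhammerSymbol, Finset.prod_range_succ, Finset.prod_range_zero]
  push_cast
  simp only [Nat.factorial_zero, Nat.cast_one]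
  nlinarith

theorem exists_stickBreakingLaw_eq_self {c : ℝ} (hc : 0 < c) {μ : Measure ℝ}
    [IsProbabilityMeasure μ] (hμ : HasFiniteMoments μ) :
    ∃ ν : Measure ℝ, IsProbabilityMeasure ν ∧ HasFiniteMoments ν ∧ stickBreakingLaw c μ ν = ν := by
  have := isProbabilityMeasure_betaOneMeasure c
  have hprob := isProbabilityMeasure_stickBreakingIterate c μ
  have hμ1 : Integrable (fun x : ℝ => x) μ := by simpa using hμ 1
  have hr := integral_id_betaOneMeasure_lt_one hc
  have hdist := dist_charFun_stickBreakingIterate_le hc hμ1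
  choose φ hφ using fun s : ℝ => cauchySeq_tendsto_of_complete
    (cauchySeq_of_le_geometric _ _ hr fun k => hdist k s)
  have hφ0 : φ 0 = 1 := tendsto_nhds_unique (hφ 0) (by simp)
  have hφc : ContinuousAt φ 0 := by
    -- Summing the geometric series from the iterate `δ₀`, whose characteristic function is `1`,
    -- gives continuity of the limit at `0`, hence tightness.
    have hb : ∀ s, dist (φ s) 1 ≤ (|s| * ∫ x, |x| ∂μ) / (1 - ∫ v, v ∂betaOneMeasure c) :=
      fun s => by
        have := dist_le_of_le_geometric_of_tendsto₀ _ _ hr (fun k => hdist k s) (hφ s)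
        rwa [stickBreakingIterate, charFun_dirac, inner_zero_left, Complex.ofReal_zero, zero_mul,
          Complex.exp_zero, dist_comm] at this
    rw [ContinuousAt, hφ0, tendsto_iff_dist_tendsto_zero]
    refine squeeze_zero (fun _ => dist_nonneg) hb ?_
    have : Continuous fun s : ℝ =>
        (|s| * ∫ x, |x| ∂μ) / (1 - ∫ v, v ∂betaOneMeasure c) := by fun_prop
    simpa using this.tendsto 0
  have htight := isTightMeasureSet_of_tendsto_charFun hφc hφ
  set ν : ℕ → ProbabilityMeasure ℝ := fun k => ⟨stickBreakingIterate c μ k, hprob k⟩ with hνdef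
  have hcomp : IsCompact (closure (Set.range ν)) := by
    refine isCompact_closure_of_isTightMeasureSet ?_
    convert! htight using 1
    ext ρ
    exact ⟨fun ⟨_, ⟨k, hk⟩, h⟩ => ⟨k, h ▸ hk ▸ rfl⟩, fun ⟨k, h⟩ => ⟨_, ⟨k, rfl⟩, h⟩⟩
  obtain ⟨ρ, -, g, hg, hlim⟩ := hcomp.tendsto_subseq
    (fun k => subset_closure (Set.mem_range_self k) : ∀ k, ν k ∈ closure (Set.range ν))
  have hφρ : ∀ s, φ s = charFun (ρ : Measure ℝ) s := fun s =>
    tendsto_nhds_unique ((hφ s).comp hg.tendsto_atTop)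
      (ProbabilityMeasure.tendsto_iff_tendsto_charFun.1 hlim s)
  simp_rw [hφρ] at hφ
  refine ⟨ρ, inferInstance, fun n => ?_, ?_⟩
  · have hfin : ∫⁻ x, ENNReal.ofReal (|x| ^ n) ∂μ < ⊤ := by
      have := (hμ n).norm.lintegral_lt_top
      simpa only [norm_pow, Real.norm_eq_abs] using this
    -- Weak convergence only gives lower semicontinuity of moments, which is enough for finiteness.
    have hle := lintegral_le_liminf_lintegral_of_forall_isOpen_measure_le_liminf_measure
      (μ := (ρ : Measure ℝ)) (μs := fun k => (ν (g k) : Measure ℝ)) (f := fun t : ℝ => |t| ^ n)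
      (by fun_prop) (fun t => by positivity)
      (fun G hG => ProbabilityMeasure.le_liminf_measure_open_of_tendsto hlim hG)
    have hle' : ∫⁻ t, ENNReal.ofReal (|t| ^ n) ∂(ρ : Measure ℝ)
        ≤ ∫⁻ x, ENNReal.ofReal (|x| ^ n) ∂μ := by
      refine hle.trans ((liminf_le_liminf (v := fun _ => ∫⁻ x, ENNReal.ofReal (|x| ^ n) ∂μ)
        (Eventually.of_forall fun k =>
          lintegral_abs_pow_stickBreakingIterate_le hc μ n (g k))).trans_eq ?_)
      exact liminf_const _
    refine ⟨by fun_prop, ?_⟩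
    rw [hasFiniteIntegral_iff_norm]
    simpa only [norm_pow, Real.norm_eq_abs] using hle'.trans_lt hfin
  · have := isProbabilityMeasure_stickBreakingLaw c μ ρ
    refine Measure.ext_of_charFun (μ := stickBreakingLaw c μ ρ) (ν := (ρ : Measure ℝ))
      (funext fun s => ?_)
    rw [charFun_stickBreakingLaw]
    refine tendsto_nhds_unique (f := fun k => charFun (stickBreakingIterate c μ (k + 1)) s)
      (l := atTop) ?_ ((hφ s).comp (tendsto_add_atTop_nat 1))
    have hs : ∀ k, charFun (stickBreakingIterate c μ (k + 1)) s = ∫ v : ℝ, charFun μ ((1 - v) * s)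
        * charFun (stickBreakingIterate c μ k) (v * s) ∂betaOneMeasure c := fun k =>
      charFun_stickBreakingLaw c μ _ s
    simp_rw [hs]
    refine tendsto_integral_filter_of_dominated_convergence (fun _ => 1)
      (Eventually.of_forall fun k =>
        (integrable_charFun_mul_charFun_betaOneMeasure _ _ _ _).aestronglyMeasurable)
      (Eventually.of_forall fun k => Eventually.of_forall fun v => ?_)
      (integrable_const _) (Eventually.of_forall fun v => (hφ _).const_mul _)
    rw [norm_mul]
    exact mul_le_one₀ (norm_charFun_le_one _) (norm_nonneg _) (norm_charFun_le_one _)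

/-! ### Moments of a stationary law -/

theorem momentRelation_of_stationary {c : ℝ} (hc : 0 < c) {μ ν : Measure ℝ}
    [IsProbabilityMeasure μ] [IsProbabilityMeasure ν] (hμ : HasFiniteMoments μ)
    (hν : HasFiniteMoments ν) (hst : stickBreakingLaw c μ ν = ν) :
    MomentRelation c (momentSeq ν) (momentSeq μ) := by
  have := isProbabilityMeasure_betaOneMeasure c
  refine ⟨by simp [momentSeq], fun n hn => ?_⟩
  have hint : ∀ i ∈ Finset.range (n + 1), Integrable (fun p : ℝ × ℝ × ℝ =>
      (n.choose i : ℝ) * (((1 - p.1) ^ (n - i) * p.1 ^ i) * (p.2.1 ^ (n - i) * p.2.2 ^ i)))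
      ((betaOneMeasure c).prod (μ.prod ν)) := fun i _ =>
    ((integrable_one_sub_pow_mul_pow_betaOneMeasure hc (n - i) i).mul_prod
      ((hμ (n - i)).mul_prod (hν i))).const_mul _
  have hmom : momentSeq ν n = ∑ i ∈ Finset.range (n + 1), (n.choose i : ℝ)
      * ((c * (n - i).factorial * pochhammerSymbol c i / pochhammerSymbol c (n + 1))
        * (momentSeq μ (n - i) * momentSeq ν i)) := by
    calc momentSeq ν n = ∫ t, t ^ n ∂(stickBreakingLaw c μ ν) := by rw [hst]; rfl
      _ = ∫ p : ℝ × ℝ × ℝ, ∑ i ∈ Finset.range (n + 1), (n.choose i : ℝ)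
            * (((1 - p.1) ^ (n - i) * p.1 ^ i) * (p.2.1 ^ (n - i) * p.2.2 ^ i))
            ∂((betaOneMeasure c).prod (μ.prod ν)) := by
          rw [stickBreakingLaw, integral_map (by fun_prop) (by fun_prop)]
          congr 1 with p
          rw [add_comm, add_pow]
          refine Finset.sum_congr rfl fun i _ => ?_
          rw [mul_pow, mul_pow]
          ring
      _ = _ := by
          rw [integral_finsetSum _ hint]
          refine Finset.sum_congr rfl fun i hi => ?_
          rw [integral_const_mul,
            integral_prod_mul (fun v : ℝ => (1 - v) ^ (n - i) * v ^ i)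
              (fun q : ℝ × ℝ => q.1 ^ (n - i) * q.2 ^ i),
            integral_prod_mul (fun x : ℝ => x ^ (n - i)) (fun t : ℝ => t ^ i),
            integral_one_sub_pow_mul_pow_betaOneMeasure hc,
            Nat.add_sub_cancel' (Finset.mem_range_succ_iff.1 hi)]
          rfl
  have hP := (pochhammerSymbol_pos hc (n + 1)).ne'
  have hsum : pochhammerSymbol c (n + 1) * momentSeq ν n
      = ∑ i ∈ Finset.range (n + 1), (n : ℝ) * (c * (((n - 1).factorial : ℝ) / i.factorial
          * pochhammerSymbol c i * momentSeq ν i * momentSeq μ (n - i))) := by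
    rw [hmom, Finset.mul_sum]
    refine Finset.sum_congr rfl fun i hi => ?_
    have hi' := Finset.mem_range_succ_iff.1 hi
    have h1 : (n.choose i : ℝ) * i.factorial * (n - i).factorial = n * (n - 1).factorial := by
      have h2 := Nat.choose_mul_factorial_mul_factorial hi'
      rw [← Nat.mul_factorial_pred (by omega : n ≠ 0)] at h2
      exact_mod_cast h2
    have hif : (i.factorial : ℝ) ≠ 0 := by positivity
    field_simp
    linear_combination (pochhammerSymbol c i * momentSeq μ (n - i) * momentSeq ν i) * h1
  have h0 : momentSeq μ 0 = 1 := by simp [momentSeq]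
  have hn0 : (n : ℝ) ≠ 0 := by exact_mod_cast (by omega : n ≠ 0)
  -- The term `i = n` contributes `c (c)_n h_n`; moved to the left it turns `(c)_{n+1} = (c)_n (c +
  -- n)` into `n (c)_n`, and `n` cancels.
  rw [Finset.sum_range_succ, ← Finset.mul_sum, ← Finset.mul_sum, Nat.sub_self, h0,
    pochhammerSymbol_succ] at hsum
  have hf : (n : ℝ) * (((n - 1).factorial : ℝ) / n.factorial) = 1 := by
    rw [← Nat.mul_factorial_pred (by omega : n ≠ 0)]
    have : ((n - 1).factorial : ℝ) ≠ 0 := by positivity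
    push_cast
    field_simp
  refine mul_left_cancel₀ hn0 ?_
  linear_combination hsum + (c * pochhammerSymbol c n * momentSeq ν n) * hf

/-! ### Injectivity of the generalized Stieltjes transform -/

/-- The left side is the complex moment generating function at `-w` of `s^(c-1) ds` on `(0, ∞)`,
hence analytic. The real Gamma integral and the identity theorem extend the formula to the
half-plane. -/
theorem integral_rpow_mul_cexp_neg_mul_Ioi {c : ℝ} (hc : 0 < c) {w : ℂ} (hw : 0 < w.re) :
    ∫ s in Set.Ioi (0 : ℝ), ((s ^ (c - 1) : ℝ) : ℂ) * Complex.exp (-(w * s))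
      = w ^ (-(c : ℂ)) * Real.Gamma c := by
  set m : Measure ℝ :=
    (volume.restrict (Set.Ioi 0)).withDensity fun s => ENNReal.ofReal (s ^ (c - 1)) with hm
  have hmeas : Measurable fun s : ℝ => ENNReal.ofReal (s ^ (c - 1)) := by fun_prop
  have hfin : ∀ᵐ s ∂volume.restrict (Set.Ioi (0 : ℝ)), ENNReal.ofReal (s ^ (c - 1)) < ⊤ :=
    Filter.Eventually.of_forall fun _ => ENNReal.ofReal_lt_top
  have hMGF : ∀ z : ℂ, ProbabilityTheory.complexMGF id m z
      = ∫ s in Set.Ioi (0 : ℝ), ((s ^ (c - 1) : ℝ) : ℂ) * Complex.exp (z * s) := fun z => by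
    rw [ProbabilityTheory.complexMGF, hm, integral_withDensity_eq_integral_toReal_smul hmeas hfin]
    refine setIntegral_congr_fun measurableSet_Ioi fun s hs => ?_
    have : 0 ≤ s ^ (c - 1) := Real.rpow_nonneg (le_of_lt hs) _
    simp [ENNReal.toReal_ofReal this]
  have hsub : Set.Iio (0 : ℝ) ⊆ interior (ProbabilityTheory.integrableExpSet id m) := by
    refine interior_maximal (fun t ht => ?_) isOpen_Iio
    change Integrable _ _
    rw [hm, integrable_withDensity_iff hmeas hfin]
    have h := integrableOn_rpow_mul_exp_neg_mul_rpow (s := c - 1) (p := 1) (b := -t)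
      (by linarith) one_pos (neg_pos.2 ht)
    refine (h.congr_fun (fun s hs => ?_) measurableSet_Ioi)
    have : 0 ≤ s ^ (c - 1) := Real.rpow_nonneg (le_of_lt hs) _
    simp [ENNReal.toReal_ofReal this, mul_comm]
  have hU : IsPreconnected {z : ℂ | z.re < 0} :=
    (convex_halfSpace_re_lt 0).isPreconnected
  have hA : AnalyticOnNhd ℂ (ProbabilityTheory.complexMGF id m) {z : ℂ | z.re < 0} :=
    ProbabilityTheory.analyticOnNhd_complexMGF.mono fun z hz => hsub hz
  have hB : AnalyticOnNhd ℂ (fun z : ℂ => (-z) ^ (-(c : ℂ)) * Real.Gamma c) {z : ℂ | z.re < 0} :=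
    (analyticOnNhd_id.neg.cpow analyticOnNhd_const fun z hz =>
      Or.inl (by simpa using hz)).mul analyticOnNhd_const
  have hreal : ∀ t : ℝ, t < 0 → ProbabilityTheory.complexMGF id m t
      = (-(t : ℂ)) ^ (-(c : ℂ)) * Real.Gamma c := fun t ht => by
    have h := Real.integral_rpow_mul_exp_neg_mul_Ioi hc (neg_pos.2 ht)
    have h' : ProbabilityTheory.complexMGF id m t
        = ((∫ s in Set.Ioi (0 : ℝ), s ^ (c - 1) * Real.exp (-(-t * s)) : ℝ) : ℂ) := by
      rw [hMGF, ← integral_complex_ofReal]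
      refine setIntegral_congr_fun measurableSet_Ioi fun s _ => ?_
      simp
    rw [h', h, one_div, Real.inv_rpow (neg_pos.2 ht).le, ← Real.rpow_neg (neg_pos.2 ht).le,
      Complex.ofReal_mul, Complex.ofReal_cpow (neg_pos.2 ht).le]
    simp
  have hfreq : ∃ᶠ z in nhdsWithin (-1 : ℂ) {-1}ᶜ, ProbabilityTheory.complexMGF id m z
      = (-z) ^ (-(c : ℂ)) * Real.Gamma c := by
    have ht : Filter.Tendsto (fun t : ℝ => (t : ℂ)) (nhdsWithin (-1) {-1}ᶜ)
        (nhdsWithin (-1 : ℂ) {-1}ᶜ) := by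
      refine tendsto_nhdsWithin_iff.2 ⟨?_, ?_⟩
      · have := (Complex.continuous_ofReal.tendsto (-1)).mono_left
          (nhdsWithin_le_nhds (s := {-1}ᶜ))
        simpa using this
      · filter_upwards [self_mem_nhdsWithin] with t ht h
        exact ht (by simpa using congrArg Complex.re h)
    refine ht.frequently (Filter.Eventually.frequently ?_)
    filter_upwards [nhdsWithin_le_nhds (Iio_mem_nhds (show (-1 : ℝ) < 0 by norm_num))] with t ht
    exact hreal t ht
  have := hA.eqOn_of_preconnected_of_frequently_eq hB hU (z₀ := -1) (by simp) hfreq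
    (x := -w) (by simpa using hw)
  rw [hMGF] at this
  simpa using this

theorem neg_I_mul_cpow {z : ℂ} (hz : 0 < z.im) (a : ℂ) :
    (-Complex.I * z) ^ a = (-Complex.I) ^ a * z ^ a := by
  have h0 : z ≠ 0 := by rintro rfl; simp at hz
  have hI : -Complex.I ≠ 0 := by simp
  have h1 := Complex.arg_nonneg_iff.2 hz.le
  have h2 := Complex.arg_le_pi z
  rw [Complex.cpow_def_of_ne_zero (mul_ne_zero hI h0), Complex.cpow_def_of_ne_zero hI,
    Complex.cpow_def_of_ne_zero h0, Complex.log_mul hI h0, add_mul, Complex.exp_add]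
  rw [Complex.arg_neg_I]
  constructor <;> linarith [Real.pi_pos]

/-- The generalized Stieltjes transform, on the line `Im z = 1`, as a Fourier integral of the
characteristic function. -/
theorem integral_cpow_eq_integral_charFun {c : ℝ} (hc : 0 < c) (ν : Measure ℝ)
    [IsProbabilityMeasure ν] (x : ℝ) :
    (-Complex.I) ^ (-(c : ℂ)) * Real.Gamma c * ∫ t : ℝ, ((x + Complex.I) - t : ℂ) ^ (-(c : ℂ)) ∂ν
      = ∫ s in Set.Ioi (0 : ℝ), ((s ^ (c - 1) * Real.exp (-s) : ℝ) : ℂ)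
          * Complex.exp (Complex.I * x * s) * charFun ν (-s) := by
  have hint : Integrable (fun s : ℝ => s ^ (c - 1) * Real.exp (-s))
      (volume.restrict (Set.Ioi 0)) := by
    simpa [mul_comm, IntegrableOn] using Real.GammaIntegral_convergent hc
  have hF : Integrable (Function.uncurry fun t s : ℝ =>
      ((s ^ (c - 1) * Real.exp (-s) : ℝ) : ℂ) * Complex.exp (Complex.I * x * s)
        * Complex.exp (((-s * t : ℝ) : ℂ) * Complex.I)) (ν.prod (volume.restrict (Set.Ioi 0))) := by
    refine (hint.norm.comp_snd ν).mono' (Measurable.aestronglyMeasurable (by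
      unfold Function.uncurry; fun_prop)) (Filter.Eventually.of_forall fun p => ?_)
    have e : Complex.I * x * p.2 = ((x * p.2 : ℝ) : ℂ) * Complex.I := by push_cast; ring
    simp only [Function.uncurry, e, norm_mul, Complex.norm_exp_ofReal_mul_I, Complex.norm_real,
      mul_one, le_refl]
  rw [← integral_const_mul]
  have h1 : ∀ t : ℝ, (-Complex.I) ^ (-(c : ℂ)) * Real.Gamma c
      * ((x + Complex.I) - t : ℂ) ^ (-(c : ℂ))
      = ∫ s in Set.Ioi (0 : ℝ), ((s ^ (c - 1) * Real.exp (-s) : ℝ) : ℂ)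
          * Complex.exp (Complex.I * x * s) * Complex.exp (((-s * t : ℝ) : ℂ) * Complex.I) := by
    intro t
    -- This `w` equals `1 - i (x - t)`: its real part `1`, due to `Im z = 1`, supplies the weight
    -- `exp (-s)`.
    have h := integral_rpow_mul_cexp_neg_mul_Ioi hc
      (w := -Complex.I * (x + Complex.I - t)) (by simp)
    rw [neg_I_mul_cpow (by simp)] at h
    rw [mul_right_comm, ← h]
    refine setIntegral_congr_fun measurableSet_Ioi fun s _ => ?_
    simp only [Complex.ofReal_mul, Complex.ofReal_exp, mul_assoc, ← Complex.exp_add]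
    congr 2
    push_cast
    linear_combination (s : ℂ) * Complex.I_mul_I
  simp_rw [h1]
  rw [integral_integral_swap hF]
  refine integral_congr_ae (Filter.Eventually.of_forall fun s => ?_)
  simp only
  rw [integral_const_mul, charFun_apply_real]
  simp

/-- Equal transforms mean that the weighted difference of characteristic functions, extended by zero
to the line, has zero Fourier transform. Inversion at a continuity point `s > 0` makes it vanish
there, and the weight is nonzero. -/
theorem charFun_eq_of_integral_cpow_eq {c : ℝ} (hc : 0 < c) (ν₁ ν₂ : Measure ℝ)
    [IsProbabilityMeasure ν₁] [IsProbabilityMeasure ν₂]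
    (h : ∀ x : ℝ, ∫ t : ℝ, ((x + Complex.I) - t : ℂ) ^ (-(c : ℂ)) ∂ν₁
      = ∫ t : ℝ, ((x + Complex.I) - t : ℂ) ^ (-(c : ℂ)) ∂ν₂) {s : ℝ} (hs : 0 < s) :
    charFun ν₁ (-s) = charFun ν₂ (-s) := by
  have hint : Integrable (fun s : ℝ => s ^ (c - 1) * Real.exp (-s))
      (volume.restrict (Set.Ioi 0)) := by
    simpa [mul_comm, IntegrableOn] using Real.GammaIntegral_convergent hc
  set g : ℝ → ℂ := fun s => ((s ^ (c - 1) * Real.exp (-s) : ℝ) : ℂ)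
    * (charFun ν₁ (-s) - charFun ν₂ (-s)) with hg
  have hterm : ∀ (ν : Measure ℝ) [IsProbabilityMeasure ν] (x : ℝ),
      IntegrableOn (fun s : ℝ => ((s ^ (c - 1) * Real.exp (-s) : ℝ) : ℂ)
          * Complex.exp (Complex.I * x * s) * charFun ν (-s)) (Set.Ioi 0) := fun ν _ x => by
    refine hint.norm.mono' (Measurable.aestronglyMeasurable ?_)
      (Filter.Eventually.of_forall fun s => ?_)
    · have := (continuous_charFun (μ := ν)).measurable
      fun_prop
    · have e : Complex.I * x * s = ((x * s : ℝ) : ℂ) * Complex.I := by push_cast; ring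
      simp only [e, norm_mul, Complex.norm_exp_ofReal_mul_I, Complex.norm_real, mul_one]
      exact mul_le_of_le_one_right (by positivity) (norm_charFun_le_one _)
  have hgi : IntegrableOn g (Set.Ioi 0) := by
    refine ((hterm ν₁ 0).sub (hterm ν₂ 0)).congr (Filter.Eventually.of_forall fun s => ?_)
    simp [hg, mul_sub]
  have hGi : Integrable ((Set.Ioi 0).indicator g) := hgi.integrable_indicator measurableSet_Ioi
  have hfourier : FourierTransform.fourier ((Set.Ioi (0 : ℝ)).indicator g) = fun _ => (0 : ℂ) := by
    funext ξ
    rw [Real.fourier_real_eq_integral_exp_smul]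
    -- The frequency `ξ` corresponds to the abscissa `x = -2πξ`.
    have e : ∀ v : ℝ, Complex.exp (((-2 * Real.pi * v * ξ : ℝ) : ℂ) * Complex.I)
        • (Set.Ioi (0 : ℝ)).indicator g v
        = (Set.Ioi (0 : ℝ)).indicator (fun s : ℝ =>
          ((s ^ (c - 1) * Real.exp (-s) : ℝ) : ℂ)
              * Complex.exp (Complex.I * ((-2 * Real.pi * ξ : ℝ) : ℂ) * s) * charFun ν₁ (-s)
            - ((s ^ (c - 1) * Real.exp (-s) : ℝ) : ℂ)
              * Complex.exp (Complex.I * ((-2 * Real.pi * ξ : ℝ) : ℂ) * s) * charFun ν₂ (-s)) v := by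
      intro v
      by_cases hv : v ∈ Set.Ioi (0 : ℝ)
      · rw [Set.indicator_of_mem hv, Set.indicator_of_mem hv, hg, smul_eq_mul]
        have : ((-2 * Real.pi * v * ξ : ℝ) : ℂ) * Complex.I
            = Complex.I * ((-2 * Real.pi * ξ : ℝ) : ℂ) * v := by push_cast; ring
        rw [this]
        ring
      · rw [Set.indicator_of_notMem hv, Set.indicator_of_notMem hv, smul_zero]
    simp_rw [e]
    rw [integral_indicator measurableSet_Ioi, integral_sub (hterm _ _) (hterm _ _),
      ← integral_cpow_eq_integral_charFun hc, ← integral_cpow_eq_integral_charFun hc, h, sub_self]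
  have hcont : ContinuousAt ((Set.Ioi (0 : ℝ)).indicator g) s := by
    have hgs : ContinuousAt g s := by
      have h1 := (continuous_charFun (μ := ν₁)).continuousAt (x := -s)
      have h2 := (continuous_charFun (μ := ν₂)).continuousAt (x := -s)
      have h3 : ContinuousAt (fun s : ℝ => s ^ (c - 1) * Real.exp (-s)) s :=
        (Real.continuousAt_rpow_const _ _ (Or.inl hs.ne')).mul (by fun_prop)
      exact (Complex.continuous_ofReal.continuousAt.comp h3).mul
        ((h1.comp continuousAt_neg).sub (h2.comp continuousAt_neg))
    refine hgs.congr ?_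
    filter_upwards [Ioi_mem_nhds hs] with v hv
    rw [Set.indicator_of_mem hv]
  have hinv := hGi.fourierInv_fourier_eq (by rw [hfourier]; exact integrable_zero _ _ _) hcont
  rw [hfourier, Real.fourierInv_eq', Set.indicator_of_mem (show s ∈ Set.Ioi (0 : ℝ) from hs), hg]
    at hinv
  simp only [smul_zero, integral_zero] at hinv
  have hpos : ((s ^ (c - 1) * Real.exp (-s) : ℝ) : ℂ) ≠ 0 := by
    have : 0 < s ^ (c - 1) * Real.exp (-s) := by positivity
    exact_mod_cast this.ne'
  exact sub_eq_zero.1 ((mul_eq_zero.1 hinv.symm).resolve_left hpos)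

/-- A probability measure is determined by its generalized Stieltjes transform on a line. -/
theorem MeasureTheory.Measure.eq_of_integral_cpow_eq {c : ℝ} (hc : 0 < c) (ν₁ ν₂ : Measure ℝ)
    [IsProbabilityMeasure ν₁] [IsProbabilityMeasure ν₂]
    (h : ∀ x : ℝ, ∫ t : ℝ, ((x + Complex.I) - t : ℂ) ^ (-(c : ℂ)) ∂ν₁
      = ∫ t : ℝ, ((x + Complex.I) - t : ℂ) ^ (-(c : ℂ)) ∂ν₂) : ν₁ = ν₂ := by
  refine Measure.ext_of_charFun (funext fun s => ?_)
  rcases lt_trichotomy s 0 with hs | rfl | hs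
  · simpa using charFun_eq_of_integral_cpow_eq hc ν₁ ν₂ h (neg_pos.2 hs)
  · simp
  · have := congrArg (starRingEnd ℂ) (charFun_eq_of_integral_cpow_eq hc ν₁ ν₂ h hs)
    simpa [charFun_neg] using this

/-! ### Uniqueness and conclusion -/

theorem MomentRelation.unique {c : ℝ} (hc : 0 < c) {h h' p : ℕ → ℝ}
    (hh : MomentRelation c h p) (hh' : MomentRelation c h' p) : h = h' := by
  funext n
  induction n using Nat.strong_induction_on with
  | _ n ih =>
    rcases Nat.eq_zero_or_pos n with rfl | hn
    · rw [hh.1, hh'.1]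
    · refine mul_left_cancel₀ (pochhammerSymbol_pos hc n).ne' ?_
      rw [hh.2 n hn, hh'.2 n hn]
      congr 1
      refine Finset.sum_congr rfl fun i hi => ?_
      rw [ih i (Finset.mem_range.1 hi)]

theorem IsMarkovKreinTransform.unique {c : ℝ} (hc : 0 < c) {μ ν₁ ν₂ : Measure ℝ}
    (h₁ : IsMarkovKreinTransform c μ ν₁) (h₂ : IsMarkovKreinTransform c μ ν₂) : ν₁ = ν₂ := by
  have := h₁.isProbabilityMeasure_target
  have := h₂.isProbabilityMeasure_target
  refine Measure.eq_of_integral_cpow_eq hc ν₁ ν₂ fun x => ?_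
  have e := (h₁.relation (x + Complex.I) (by simp)).trans
    (h₂.relation (x + Complex.I) (by simp)).symm
  simpa only [one_div, ← Complex.cpow_neg] using e

theorem HasFiniteMoments.integrable_log {μ : Measure ℝ} (hμ : HasFiniteMoments μ) :
    Integrable (fun u : ℝ => Real.log (1 + |u|)) μ := by
  have h1 : Integrable (fun u : ℝ => u) μ := by simpa using hμ 1
  refine h1.abs.mono' (Measurable.aestronglyMeasurable (by fun_prop))
    (Filter.Eventually.of_forall fun u => ?_)
  rw [Real.norm_of_nonneg (Real.log_nonneg (by linarith [abs_nonneg u]))]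
  have := Real.log_le_sub_one_of_pos (show 0 < 1 + |u| by positivity)
  linarith

theorem exists_isMarkovKreinTransform {c : ℝ} (hc : 0 < c) {μ : Measure ℝ}
    [IsProbabilityMeasure μ] (hμ : HasFiniteMoments μ) :
    ∃ ν : Measure ℝ, IsMarkovKreinTransform c μ ν ∧ HasFiniteMoments ν ∧
      MomentRelation c (momentSeq ν) (momentSeq μ) := by
  obtain ⟨ν, hνp, hν, hst⟩ := exists_stickBreakingLaw_eq_self hc hμ
  exact ⟨ν, isMarkovKreinTransform_of_stationary hc hμ.integrable_log hst, hν,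
    momentRelation_of_stationary hc hμ hν hst⟩

theorem mainTheorem5 (c : ℝ) (hc : 0 < c) :
    (∀ μ : Measure ℝ, IsProbabilityMeasure μ → HasFiniteMoments μ →
      (∃! ν : Measure ℝ, IsMarkovKreinTransform c μ ν) ∧
      (∃! h : ℕ → ℝ, MomentRelation c h (momentSeq μ)) ∧
      ∀ (ν : Measure ℝ) (h : ℕ → ℝ),
        IsMarkovKreinTransform c μ ν → MomentRelation c h (momentSeq μ) →
          HasFiniteMoments ν ∧ ∀ n : ℕ, momentSeq ν n = h n) ∧
    (∀ μ ν : Measure ℝ, IsDeterminedByMoments μ → IsDeterminedByMoments ν →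
      (MomentRelation c (momentSeq ν) (momentSeq μ) ↔ IsMarkovKreinTransform c μ ν)) := by
  refine ⟨fun μ hμp hμ => ?_, fun μ ν hμ hν => ?_⟩
  · obtain ⟨ρ, hρ, hρm, hrel⟩ := exists_isMarkovKreinTransform hc hμ
    refine ⟨⟨ρ, hρ, fun ν hν => hν.unique hc hρ⟩,
      ⟨momentSeq ρ, hrel, fun h hh => hh.unique hc hrel⟩, fun ν h hν hh => ?_⟩
    rw [hν.unique hc hρ, hh.unique hc hrel]
    exact ⟨hρm, fun _ => rfl⟩
  · have := hμ.isProbabilityMeasure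
    obtain ⟨ρ, hρ, hρm, hrel⟩ := exists_isMarkovKreinTransform hc hμ.hasFiniteMoments
    refine ⟨fun h => ?_, fun h => ?_⟩
    -- The transform `ρ` of `μ` satisfies the same recursion, so it has the moments of `ν`, and
    -- determinacy of `ν` identifies the two.
    · rwa [← hν.eq_of_moments_eq ρ hρ.isProbabilityMeasure_target hρm
        (congrFun (hrel.unique hc h))]
    · rwa [h.unique hc hρ]
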